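/- Let $M$ be $\mathbb N$ (the non-negative integers) or $\mathbb Z$, let $k$ be a field of characteristic zero, and let $k_0\subseteq k$ be a computable subfield, i.e. a subfield together with a surjection $\nu\colon\mathbb N\to k_0$ such that the relation $\nu(a)=\nu(b)$ is decidable and addition and multiplication of $k_0$ are induced by computable functions on names $a,b\in\mathbb N$. The set $k^M$ of sequences $(x_m)_{m\in M}$ is a ring under componentwise operations, with the shift $\sigma\bigl((x_m)_{m\in M}\bigr)=(x_{m+1})_{m\in M}$. A difference polynomial over $k_0$ in variables $X_1,\dots,X_n$ is an element $f$ of the polynomial ring $k_0[\sigma^j(X_i)\mid 1\le i\le n,\ j\in\mathbb N]$; its value $f(\mathbf x)\in k^M$ at $\mathbf x\in(k^M)^n$ is obtained by substituting $\sigma^j(x_i)$ for $\sigma^j(X_i)$. Difference polynomials are given to algorithms as finite lists of terms, with coefficients given by names. Then the following problem is undecidable: given $n\in\mathbb N$, a finite system $F=\{f_1,\dots,f_\ell\}$ of difference polynomials and a difference polynomial $g$ in $n$ variables with coefficients in $k_0$, determine whether $g=0$ holds for every solution of $F=0$ in $k^M$, that is, whether $g(\mathbf x)=0$ for every $\mathbf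 x\in(k^M)^n$ with $f_1(\mathbf x)=\dots=f_\ell(\mathbf x)=0$. That is, there is no algorithm that answers this correctly for all such inputs. -/

import Mathlib

/-- A computable presentation of a field `K`: a surjective naming of the elements of `K` by natural
numbers for which equality of named elements is decidable and addition and multiplication are
computable on names. (Names of `0`, `1`, opposites and inverses can then be found by search.)
A field is computable if it has such a presentation. -/
structure ComputablePresentation (K : Type*) [Field K] where
  elt : ℕ → K
  surjective_elt : Function.Surjective elt
  computable_eq : ComputablePred fun p : ℕ × ℕ => elt p.1 = elt p.2
  computable_add : ∃ f : ℕ → ℕ → ℕ, Computable₂ f ∧ ∀ a b, elt (f a b) = elt a + elt b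
  computable_mul : ∃ f : ℕ → ℕ → ℕ, Computable₂ f ∧ ∀ a b, elt (f a b) = elt a * elt b

/-- The ring of difference polynomials in `n` variables over a ring `A` of constants. The
indeterminate `(i, j)` is `σ ^ j (X i)`. -/
abbrev DiffPoly (n : ℕ) (A : Type*) [CommRing A] : Type _ := MvPolynomial (Fin n × ℕ) A

/-- The shift `(x m)_m ↦ (x (m + 1))_m` on the ring of sequences indexed by `M` (used for `M = ℕ`
and `M = ℤ`). -/
def seqShift (M : Type*) [AddMonoidWithOne M] (R : Type*) [CommRing R] : (M → R) →+* (M → R) where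
  toFun x m := x (m + 1)
  map_one' := rfl
  map_mul' _ _ := rfl
  map_zero' := rfl
  map_add' _ _ := rfl

/-- The value `f(x)` of a difference polynomial `f` over `A` at a tuple `x` of `M`-sequences with
entries in an `A`-algebra `R`: it is the homomorphism of `A`-algebras that sends `σ ^ j (X i)` to
`σ ^ j (x i)`. -/
noncomputable def DiffPoly.evalSeq (M : Type*) [AddMonoidWithOne M] {A R : Type*} [CommRing A]
    [CommRing R] [Algebra A R] {n : ℕ} (x : Fin n → M → R) (f : DiffPoly n A) : M → R :=
  MvPolynomial.aeval (fun v : Fin n × ℕ => (seqShift M R)^[v.2] (x v.1)) f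

/-- The equation `g = 0` holds for every solution of the system `F = 0` in `R ^ M`. -/
def HoldsOnSolutions (M : Type*) [AddMonoidWithOne M] {A : Type*} (R : Type*) [CommRing A]
    [CommRing R] [Algebra A R] {n : ℕ} (F : List (DiffPoly n A)) (g : DiffPoly n A) : Prop :=
  ∀ x : Fin n → M → R, (∀ f ∈ F, DiffPoly.evalSeq M x f = 0) → DiffPoly.evalSeq M x g = 0

/-- Finite descriptions of difference polynomials: a list of terms, each of which consists of a name
of its coefficient and of the list of the factors `(i, j)`, standing for `σ ^ j (X i)`, of its
monomial (with repetitions). -/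
abbrev DiffPolyCode : Type := List (ℕ × List (ℕ × ℕ))

/-- Finite descriptions of the inputs: the number of variables, the system `F` and the
polynomial `g`. -/
abbrev InputCode : Type := ℕ × List DiffPolyCode × DiffPolyCode

/-- `c` describes the difference polynomial `f` in `n` variables, that is, all variable indices in
`c` are less than `n`, and `f` is the sum of the terms listed in `c`. -/
def ComputablePresentation.Codes {K : Type*} [Field K] (ν : ComputablePresentation K) {n : ℕ}
    (c : DiffPolyCode) (f : DiffPoly n K) : Prop :=
  ∃ t : List (ℕ × List (Fin n × ℕ)),
    c = t.map (fun s => (s.1, s.2.map fun v => ((v.1 : ℕ), v.2))) ∧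
    f = (t.map fun s => MvPolynomial.C (ν.elt s.1) * (s.2.map MvPolynomial.X).prod).sum

/-- `c` describes the input that consists of the system `F` and the polynomial `g`, in `n`
variables. -/
def ComputablePresentation.CodesInput {K : Type*} [Field K] (ν : ComputablePresentation K) {n : ℕ}
    (c : InputCode) (F : List (DiffPoly n K)) (g : DiffPoly n K) : Prop :=
  c.1 = n ∧ List.Forall₂ ν.Codes c.2.1 F ∧ ν.Codes c.2.2 g

/-- There is an algorithm that, given (a description of) a finite system `F = 0` and an equation
`g = 0` of difference polynomials over `K`, in any number of variables, determines whether `g = 0`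
holds for every solution of `F = 0` in `R ^ M`. Its output matters only on descriptions of
inputs. -/
def DecidableConsequence (M : Type*) [AddMonoidWithOne M] {K : Type*} [Field K]
    (ν : ComputablePresentation K) (R : Type*) [CommRing R] [Algebra K R] : Prop :=
  ∃ D : InputCode → Bool, Computable D ∧
    ∀ (n : ℕ) (F : List (DiffPoly n K)) (g : DiffPoly n K) (c : InputCode),
      ν.CodesInput c F g → (D c = true ↔ HoldsOnSolutions M R F g)

/-!
The halting problem is reduced to the problem in question. Along a solution of a system of
difference equations the values at time `m + 1` may be related to those at time `m` by arbitrary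
polynomial equations, so a system can force its solutions to follow the run of a register machine
with registers in `ℕ ⊆ k`. The only step that is not polynomial, the test whether two registers
`x`, `y` are equal, becomes polynomial with an auxiliary variable `w`: if `p` is the next address,
`l` the address for `x = y` and `l'` the one for `x ≠ y`, the equations `(x - y) * (p - l') = 0`
and `(p - l) * ((x - y) * w - 1) = 0` have a solution `w` exactly if `p` is the correct address.
The instruction to be executed is selected by Lagrange factors `∏ i ≠ j, (p - i)`, and one more
equation excludes the addresses at which the machine has halted (`stepEqs`).

The initial configuration has to be imposed at one time only, although the equations of a system
hold at all times. To this end the equations of the initial configuration are multiplied by a start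
flag `e`, those of a step by an activity flag that is `1` when `e ≠ 0` and remains `1` afterwards
(`machineEqs`). A solution with `e m ≠ 0` for some `m` then contains an infinite run from time `m`
on. Conversely, an infinite run gives a solution with `e 0 = 1` in which everything vanishes at
negative times, if there are any. So the system implies `e = 0` if and only if the machine halts,
for sequences indexed by `ℕ` as well as by `ℤ` (`holdsOnSolutions_iff`).

It remains to have a register machine with an undecidable halting problem
(`exists_program_halting`). A fixed program that works on an input `N` suffices, as then `N` enters
the system just as a constant of `ℤ ⊆ k₀`, a name of which is computable. Programs for primitive
recursive functions are obtained by induction (`exists_realizable_of_primrec`), and the program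
searches for a time bound within which the bounded evaluation of the code `N` succeeds.
-/

/-! ### Register machines -/

/-- An instruction of a register machine: `affine r c s d` assigns `c * x_s + d` to register `r`,
and `jeq a b l` jumps to address `l` if registers `a` and `b` have equal contents. -/
inductive Instr : Type
  | affine (r c s d : ℕ)
  | jeq (a b l : ℕ)

namespace RegisterMachine

/-- A configuration: the address of the next instruction and the contents of the registers. -/
abbrev Config : Type := ℕ × (ℕ → ℕ)

/-- The effect of an instruction. -/
def exec : Instr → Config → Config
  | .affine r c s d, (pc, x) => (pc + 1, Function.update x r (c * x s + d))
  | .jeq a b l, (pc, x) => (if x a = x b then l else pc + 1, x)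

/-- One step of the program `P`. A configuration whose address lies outside `P` does not change. -/
def step (P : List Instr) (c : Config) : Config :=
  match P[c.1]? with
  | none => c
  | some I => exec I c

/-- The program `P` leads from `c` to `c'` in at least one step. -/
def Runs (P : List Instr) (c c' : Config) : Prop := ∃ t, (step P)^[t + 1] c = c'

theorem Runs.trans {P : List Instr} {a b c : Config} (h : Runs P a b) (h' : Runs P b c) :
    Runs P a c := by
  obtain ⟨s, rfl⟩ := h
  obtain ⟨t, rfl⟩ := h'
  exact ⟨t + 1 + s, by rw [← Function.iterate_add_apply]; congr 1⟩

theorem Runs.of_getElem? {P : List Instr} {c : Config} {I : Instr} (h : P[c.1]? = some I) :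
    Runs P c (exec I c) :=
  ⟨0, by simp [step, h]⟩

/-- The map `φ` of stores is computed by a piece of code. Since jumps are absolute, the code is a
function of the address at which it is placed. -/
def Realizable (φ : (ℕ → ℕ) → ℕ → ℕ) : Prop :=
  ∃ code : ℕ → List Instr, ∀ (A B : List Instr) (x : ℕ → ℕ),
    Runs (A ++ code A.length ++ B) (A.length, x) (A.length + (code A.length).length, φ x)

theorem Realizable.affine (r c s d : ℕ) :
    Realizable fun x => Function.update x r (c * x s + d) :=
  ⟨fun _ => [.affine r c s d], fun A B x => Runs.of_getElem? (I := .affine r c s d) (by simp)⟩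

theorem Realizable.comp {φ ψ : (ℕ → ℕ) → ℕ → ℕ} (hψ : Realizable ψ) (hφ : Realizable φ) :
    Realizable fun x => ψ (φ x) := by
  obtain ⟨p, hp⟩ := hφ
  obtain ⟨q, hq⟩ := hψ
  refine ⟨fun o => p o ++ q (o + (p o).length), fun A B x => ?_⟩
  have h₁ := hp A (q (A.length + (p A.length).length) ++ B) x
  have h₂ := hq (A ++ p A.length) B (φ x)
  simp only [List.append_assoc, List.length_append, ← add_assoc] at h₁ h₂ ⊢
  exact h₁.trans h₂

/-- A counting loop: `φ` is executed with `0, …, x_n - 1` in the register `i`, where `φ` must not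
change the registers `i` and `n`. -/
theorem Realizable.loop {φ : (ℕ → ℕ) → ℕ → ℕ} (hφ : Realizable φ) {i n : ℕ} (hin : i ≠ n)
    (hi : ∀ x, φ x i = x i) (hn : ∀ x, φ x n = x n) :
    Realizable fun x => (fun y => Function.update (φ y) i (φ y i + 1))^[x n]
      (Function.update x i 0) := by
  obtain ⟨p, hp⟩ := (Realizable.affine i 1 i 1).comp hφ
  simp only [one_mul] at hp
  set ψ : (ℕ → ℕ) → ℕ → ℕ := fun y => Function.update (φ y) i (φ y i + 1) with hψ
  refine ⟨fun o => .affine i 0 i 0 :: .jeq i n (o + 3 + (p (o + 2)).length) ::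
    (p (o + 2) ++ [.jeq i i (o + 1)]), fun A B x => ?_⟩
  set o := A.length with ho
  set P := A ++ (.affine i 0 i 0 :: .jeq i n (o + 3 + (p (o + 2)).length) ::
    (p (o + 2) ++ [.jeq i i (o + 1)])) ++ B with hP
  have h0 : Runs P (o, x) (o + 1, Function.update x i 0) := by
    simpa [exec] using Runs.of_getElem? (c := (o, x)) (I := .affine i 0 i 0)
      (by simp [hP, ho] : P[o]? = _)
  have hP1 : P[o + 1]? = some (.jeq i n (o + 3 + (p (o + 2)).length)) := by
    simp [hP, ho]
  have hbody (y : ℕ → ℕ) : Runs P (o + 2, y) (o + 2 + (p (o + 2)).length, ψ y) := by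
    have := hp (A ++ [.affine i 0 i 0, .jeq i n (o + 3 + (p (o + 2)).length)])
      (.jeq i i (o + 1) :: B) y
    simpa [hP, ho] using this
  have hback (y : ℕ → ℕ) : Runs P (o + 2 + (p (o + 2)).length, y) (o + 1, y) := by
    simpa [exec] using Runs.of_getElem? (c := (o + 2 + (p (o + 2)).length, y))
      (I := .jeq i i (o + 1)) (by
        have e : o + 2 + (p (o + 2)).length - A.length = (p (o + 2)).length + 1 + 1 := by omega
        rw [hP, List.append_assoc, List.getElem?_append_right (by omega), e]
        simp)
  have key (t : ℕ) : ∀ y : ℕ → ℕ, y i + t = y n →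
      Runs P (o + 1, y) (o + 3 + (p (o + 2)).length, ψ^[t] y) := by
    induction t with
    | zero =>
      intro y hy
      have := Runs.of_getElem? (c := (o + 1, y)) hP1
      simpa [exec, show y i = y n by simpa using hy] using this
    | succ t ih =>
      intro y hy
      have h1 := Runs.of_getElem? (c := (o + 1, y)) hP1
      simp only [exec, if_neg (show y i ≠ y n by omega)] at h1
      refine h1.trans ((hbody y).trans ((hback _).trans (ih (ψ y) ?_)))
      simp only [hψ, Function.update_self, Function.update_of_ne hin.symm, hi, hn]
      omega
  have h3 := h0.trans (key (x n) (Function.update x i 0) (by simp [Function.update_of_ne hin.symm]))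
  convert h3 using 2
  simp
  omega

/-- Primitive recursive functions are computed by register machines: inputs are read from the
registers `ins`, the value is written to `out`, and the other registers below `b` keep their
contents. The register `out` may be one of the inputs. -/
theorem exists_realizable_of_primrec {n : ℕ} {f : List.Vector ℕ n → ℕ} (hf : Nat.Primrec' f) :
    ∀ (ins : Fin n → ℕ) (out b : ℕ), (∀ i, ins i < b) → out < b →
      ∃ φ, Realizable φ ∧ ∀ x, φ x out = f (List.Vector.ofFn fun i => x (ins i)) ∧
        ∀ r < b, r ≠ out → φ x r = x r := by
  induction hf with
  | zero =>
    intro ins out b _ _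
    exact ⟨_, Realizable.affine out 0 out 0, fun x => ⟨by simp, fun r _ hr => by simp [hr]⟩⟩
  | succ =>
    intro ins out b _ _
    exact ⟨_, Realizable.affine out 1 (ins 0) 1, fun x => ⟨by simp, fun r _ hr => by simp [hr]⟩⟩
  | get i =>
    intro ins out b _ _
    exact ⟨_, Realizable.affine out 1 (ins i) 0, fun x => ⟨by simp, fun r _ hr => by simp [hr]⟩⟩
  | @comp m n f g hf hg ihf ihg =>
    intro ins out b hins hout
    -- The values of the first `l` inner functions are stored in the registers `b, …, b + l - 1`.
    have inner (l : ℕ) (hl : l ≤ n) : ∃ φ, Realizable φ ∧ ∀ x, (∀ j : Fin n, j.1 < l →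
        φ x (b + j) = g j (List.Vector.ofFn fun i => x (ins i))) ∧ ∀ r < b, φ x r = x r := by
      induction l with
      | zero => exact ⟨_, Realizable.affine b 1 b 0, fun x => ⟨by simp, fun r _ => by simp⟩⟩
      | succ l ih =>
        obtain ⟨φ, hφ, h⟩ := ih (by omega)
        obtain ⟨ψ, hψ, h'⟩ := ihg ⟨l, hl⟩ ins (b + l) (b + n)
          (fun i => (hins i).trans_le (by omega)) (by omega)
        refine ⟨_, hψ.comp hφ, fun x => ⟨fun j hj => ?_, fun r hr => ?_⟩⟩
        · rcases Nat.lt_succ_iff_lt_or_eq.1 hj with hj | hj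
          · rw [(h' _).2 _ (by omega) (by omega), (h x).1 j hj]
          · obtain rfl : j = ⟨l, hl⟩ := Fin.ext hj
            rw [(h' _).1]
            simp only [(h x).2 _ (hins _)]
        · rw [(h' _).2 _ (by omega) (by omega), (h x).2 r hr]
    obtain ⟨φ, hφ, h⟩ := inner n le_rfl
    obtain ⟨ψ, hψ, h'⟩ := ihf (fun j => b + j) out (b + n) (fun j => by omega) (by omega)
    refine ⟨_, hψ.comp hφ, fun x => ⟨?_, fun r hr hr' => ?_⟩⟩
    · rw [(h' _).1]
      simp only [(h x).1 _ (Fin.is_lt _)]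
    · rw [(h' _).2 _ (by omega) hr', (h x).2 r hr]
  | @prec n f g hf hg ihf ihg =>
    intro ins out b hins hout
    -- Register `b` holds the accumulator and register `b + 1` the recursion variable.
    obtain ⟨φ, hφ, h⟩ := ihf (fun i => ins i.succ) b (b + 2)
      (fun i => (hins _).trans (by omega)) (by omega)
    obtain ⟨ψ, hψ, h'⟩ := ihg (Fin.cons (b + 1) (Fin.cons b fun i => ins i.succ)) b (b + 2)
      (fun i => by
        refine Fin.cases (by simp) (fun i => Fin.cases (by simp) (fun i => ?_) i) i
        simpa using (hins _).trans (by omega)) (by omega)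
    have h0 := hins 0
    have hloop := hψ.loop (i := b + 1) (n := ins 0) (by omega)
      (fun x => (h' x).2 _ (by omega) (by omega)) (fun x => (h' x).2 _ (by omega) (by omega))
    refine ⟨_, (Realizable.affine out 1 b 0).comp (hloop.comp hφ), fun x => ?_⟩
    set y := Function.update (φ x) (b + 1) 0 with hy
    have inv (t : ℕ) : let z := (fun y => Function.update (ψ y) (b + 1) (ψ y (b + 1) + 1))^[t] y
        (z (b + 1) = t ∧ ∀ r < b, z r = x r) ∧
          z b = Nat.rec (motive := fun _ => ℕ) (f (List.Vector.ofFn fun i => x (ins i.succ)))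
            (fun k IH => g (k ::ᵥ IH ::ᵥ List.Vector.ofFn fun i => x (ins i.succ))) t := by
      induction t with
      | zero =>
        refine ⟨⟨by simp [hy], fun r hr => ?_⟩, ?_⟩
        · simp only [Function.iterate_zero, id, hy]
          rw [Function.update_of_ne (by omega), (h x).2 r (by omega) (by omega)]
        · simp only [Function.iterate_zero, id, hy]
          rw [Function.update_of_ne (by omega)]
          exact (h x).1
      | succ t ih =>
        simp only [Function.iterate_succ_apply']
        obtain ⟨⟨h1, h2⟩, h3⟩ := ih
        refine ⟨⟨?_, fun r hr => ?_⟩, ?_⟩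
        · rw [Function.update_self, (h' _).2 _ (by omega) (by omega), h1]
        · rw [Function.update_of_ne (by omega), (h' _).2 _ (by omega) (by omega), h2 r hr]
        · rw [Function.update_of_ne (by omega), (h' _).1]
          simp only [List.Vector.ofFn, Fin.cons_zero, Fin.cons_succ, h1, h3, h2 _ (hins _)]
    have hx : φ x (ins 0) = x (ins 0) := (h x).2 _ (by omega) (by omega)
    refine ⟨?_, fun r hr hr' => ?_⟩
    · simp only [hx, Function.update_self, (inv (x (ins 0))).2, one_mul, add_zero]
      simp [List.Vector.ofFn]
    · simp only [hx, Function.update_of_ne hr']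
      exact (inv (x (ins 0))).1.2 r hr

/-- The configuration at address `0` in which register `1` contains the input `N` and all other
registers contain `0`. -/
def initial (N : ℕ) : Config := (0, Function.update (fun _ => 0) 1 N)

theorem step_of_length_le {P : List Instr} {c : Config} (h : P.length ≤ c.1) : step P c = c := by
  simp [step, List.getElem?_eq_none h]

/-- A fixed program solves the halting problem as a partial function: started on `N`, it leaves the
range of its addresses if and only if the `N`-th code halts on `0`. It searches for a time bound
within which the (primitive recursive) bounded evaluation of the code succeeds. -/
theorem exists_program_halting : ∃ P : List Instr, ∀ N : ℕ,
    (∃ t, P.length ≤ ((step P)^[t] (initial N)).1) ↔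
      (Nat.Partrec.Code.eval (Denumerable.ofNat Nat.Partrec.Code N) 0).Dom := by
  let f : List.Vector ℕ 2 → ℕ := fun v =>
    if (Nat.Partrec.Code.evaln (v.get 0) (Denumerable.ofNat _ (v.get 1)) 0).isSome then 1 else 0
  have hf : Nat.Primrec' f := by
    refine Nat.Primrec'.of_prim (Primrec.ite ?_ (Primrec.const _) (Primrec.const _))
    refine Primrec.eq.comp (Primrec.option_isSome.comp ?_) (Primrec.const true)
    exact Nat.Partrec.Code.primrec_evaln.comp (((Primrec.vector_get.comp .id (.const 0)).pair
      ((Primrec.ofNat _).comp (Primrec.vector_get.comp .id (.const 1)))).pair (.const 0))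
  -- Registers: `0` time bound, `1` input, `2` value of `f`, `3` the constant zero.
  obtain ⟨φ, hφ, h⟩ := exists_realizable_of_primrec hf ![0, 1] 2 4 (by simp [Fin.forall_fin_two])
    (by omega)
  obtain ⟨p, hp⟩ := (Realizable.affine 0 1 0 1).comp hφ
  set ψ : (ℕ → ℕ) → ℕ → ℕ := fun x => Function.update (φ x) 0 (1 * φ x 0 + 1)
  refine ⟨p 0 ++ [.jeq 2 3 0], fun N => ?_⟩
  set P := p 0 ++ [.jeq 2 3 0] with hP
  have hlen : P.length = (p 0).length + 1 := by simp [hP]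
  have hv (t : ℕ) : f (t ::ᵥ N ::ᵥ List.Vector.nil) ≠ 0 ↔
      (Nat.Partrec.Code.evaln t (Denumerable.ofNat Nat.Partrec.Code N) 0).isSome := by
    have e : (t ::ᵥ N ::ᵥ List.Vector.nil).get 1 = N := rfl
    simp [f, e, Option.isSome_iff_ne_none]
  have hdom : (Nat.Partrec.Code.eval (Denumerable.ofNat Nat.Partrec.Code N) 0).Dom ↔
      ∃ t, f (t ::ᵥ N ::ᵥ List.Vector.nil) ≠ 0 := by
    simp only [hv, Option.isSome_iff_exists, Part.dom_iff_mem, Nat.Partrec.Code.evaln_complete]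
    exact exists_comm
  -- The stores at the beginning of the `t`-th round.
  let Good (t : ℕ) (x : ℕ → ℕ) : Prop := x 0 = t ∧ x 1 = N ∧ x 3 = 0
  have round (t : ℕ) (x : ℕ → ℕ) (hx : Good t x) : ∃ y, Good (t + 1) y ∧
      Runs P (0, x) (if f (t ::ᵥ N ::ᵥ List.Vector.nil) = 0 then 0 else P.length, y) := by
    obtain ⟨h0, h1, h3⟩ := hx
    have e0 : φ x 0 = x 0 := (h x).2 0 (by omega) (by omega)
    have e1 : φ x 1 = x 1 := (h x).2 1 (by omega) (by omega)
    have e3 : φ x 3 = x 3 := (h x).2 3 (by omega) (by omega)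
    have e2 : φ x 2 = f (t ::ᵥ N ::ᵥ List.Vector.nil) := by
      rw [(h x).1]; simp [List.Vector.ofFn, h0, h1]
    refine ⟨ψ x, ⟨?_, ?_, ?_⟩, ?_⟩
    · simp [ψ, e0, h0]
    · simp [ψ, e1, h1]
    · simp [ψ, e3, h3]
    · have r1 := hp [] [.jeq 2 3 0] x
      simp only [List.length_nil, List.nil_append, zero_add] at r1
      have r2 := Runs.of_getElem? (P := P) (c := ((p 0).length, ψ x)) (I := .jeq 2 3 0)
        (by simp [hP])
      convert r1.trans r2 using 1
      simp [exec, ψ, e2, e3, h3, hlen]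
  have hinit : Good 0 (initial N).2 := by simp [Good, initial]
  rw [hdom]
  constructor
  · -- If no value of `f` were nonzero, the program would return to address `0` arbitrarily late.
    rintro ⟨t, ht⟩
    by_contra! hall
    have late (s : ℕ) : ∃ T ≥ s, ∃ y, Good s y ∧ (step P)^[T] (initial N) = (0, y) := by
      induction s with
      | zero => exact ⟨0, le_rfl, _, hinit, rfl⟩
      | succ s ih =>
        obtain ⟨T, hT, y, hy, e⟩ := ih
        obtain ⟨z, hz, u, hu⟩ := round s y hy
        rw [if_pos (hall s)] at hu
        exact ⟨u + 1 + T, by omega, z, hz, by rw [Function.iterate_add_apply, e, hu]⟩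
    obtain ⟨T, hT, y, -, e⟩ := late t
    obtain ⟨u, rfl⟩ := Nat.exists_eq_add_of_le' hT
    rw [Function.iterate_add_apply, Function.iterate_fixed (step_of_length_le ht)] at e
    rw [e] at ht
    simp [hlen] at ht
  · rintro hex
    classical
    have hmin := Nat.find_spec hex
    have before (s : ℕ) (hs : s ≤ Nat.find hex) :
        ∃ T y, Good s y ∧ (step P)^[T] (initial N) = (0, y) := by
      induction s with
      | zero => exact ⟨0, _, hinit, rfl⟩
      | succ s ih =>
        obtain ⟨T, y, hy, e⟩ := ih (by omega)
        obtain ⟨z, hz, u, hu⟩ := round s y hy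
        rw [if_pos (not_not.1 (Nat.find_min hex (m := s) (by omega)))] at hu
        exact ⟨u + 1 + T, z, hz, by rw [Function.iterate_add_apply, e, hu]⟩
    obtain ⟨T, y, hy, e⟩ := before _ le_rfl
    obtain ⟨z, hz, u, hu⟩ := round _ y hy
    rw [if_neg hmin] at hu
    exact ⟨u + 1 + T, by rw [Function.iterate_add_apply, e, hu]⟩

end RegisterMachine

/-! ### Difference systems that simulate register machines -/

namespace RegisterMachine

open MvPolynomial

/-- The number `i` as an index of one of `R + 4` variables; it is reduced modulo `R + 4`, which
plays no role for the indices in use. -/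
def varIndex (R i : ℕ) : Fin (R + 4) := ⟨i % (R + 4), Nat.mod_lt _ (by omega)⟩

theorem val_varIndex {R i : ℕ} (h : i < R + 4) : (varIndex R i : ℕ) = i := Nat.mod_eq_of_lt h

/-- The difference indeterminate `σ ^ j (X i)` among `R + 4` variables. The variables with `i < 4`
are a start flag (`0`), an activity flag (`1`), an auxiliary variable that takes the values of
inverses (`2`) and the address of the next instruction (`3`); the variable `r + 4` is the
register `r`. -/
noncomputable def indet (K : Type*) [Field K] (R i j : ℕ) : DiffPoly (R + 4) K :=
  X (varIndex R i, j)

/-- All registers that occur in the instruction have index less than `R`. -/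
def UsesBelow (R : ℕ) : Instr → Prop
  | .affine r _ s _ => r < R ∧ s < R
  | .jeq a b _ => a < R ∧ b < R

theorem exists_usesBelow (P : List Instr) : ∃ R, 2 ≤ R ∧ ∀ I ∈ P, UsesBelow R I := by
  induction P with
  | nil => exact ⟨2, le_rfl, by simp⟩
  | cons I P ih =>
    obtain ⟨R, hR, h⟩ := ih
    cases I with
    | affine r c s d =>
      refine ⟨R + r + s + 1, by omega, List.forall_mem_cons.2 ⟨⟨by omega, by omega⟩, ?_⟩⟩
      intro J hJ
      have := h J hJ
      cases J <;> simp only [UsesBelow] at * <;> omega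
    | jeq a b l =>
      refine ⟨R + a + b + 1, by omega, List.forall_mem_cons.2 ⟨⟨by omega, by omega⟩, ?_⟩⟩
      intro J hJ
      have := h J hJ
      cases J <;> simp only [UsesBelow] at * <;> omega

/-- The equations between a configuration with address `j` and its successor under the given
instruction. For a jump, the first two equations say that the new address is `l` or `j + 1`
according to whether the difference of the two registers is zero or is inverted by the auxiliary
variable. -/
noncomputable def execEqs (K : Type*) [Field K] (R j : ℕ) : Instr → List (DiffPoly (R + 4) K)
  | .affine r c s d =>
    (indet K R 3 1 - (j + 1 : ℕ)) :: (List.range R).map fun q => indet K R (q + 4) 1 -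
      if q = r then (c : DiffPoly (R + 4) K) * indet K R (s + 4) 0 + d else indet K R (q + 4) 0
  | .jeq a b l =>
    (indet K R (a + 4) 0 - indet K R (b + 4) 0) * (indet K R 3 1 - (j + 1 : ℕ)) ::
    (indet K R 3 1 - (l : DiffPoly (R + 4) K)) *
      ((indet K R (a + 4) 0 - indet K R (b + 4) 0) * indet K R 2 0 - 1) ::
    (List.range R).map fun q => indet K R (q + 4) 1 - indet K R (q + 4) 0

/-- The equations of the program `P`, to be imposed at the times at which the machine is active:
it stays active, the address lies inside `P`, so that `P` has not halted, and the instruction at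
this address is executed. The product over `i ≠ j` makes the equations of the instruction at the
address `j` void at the other addresses. -/
noncomputable def stepEqs (K : Type*) [Field K] (P : List Instr) (R : ℕ) :
    List (DiffPoly (R + 4) K) :=
  (indet K R 1 1 - 1) ::
    (∏ i ∈ Finset.range P.length, (indet K R 3 0 - (i : DiffPoly (R + 4) K))) ::
    P.zipIdx.flatMap fun I => (execEqs K R I.2 I.1).map
      ((∏ i ∈ (Finset.range P.length).erase I.2, (indet K R 3 0 - (i : DiffPoly (R + 4) K))) * ·)

/-- The equations of the initial configuration, except for the value of the input register `1`. -/
noncomputable def initEqs (K : Type*) [Field K] (R : ℕ) : List (DiffPoly (R + 4) K) :=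
  (indet K R 1 0 - 1) :: indet K R 3 0 ::
    ((List.range R).filter (· ≠ 1)).map fun r => indet K R (r + 4) 0

/-- The difference system of the program `P`. Since it consists of multiples of the activity flag
and of the start flag, it is void at times at which both flags vanish. -/
noncomputable def machineEqs (K : Type*) [Field K] (P : List Instr) (R : ℕ) :
    List (DiffPoly (R + 4) K) :=
  (stepEqs K P R).map (indet K R 1 0 * ·) ++ (initEqs K R).map (indet K R 0 0 * ·)

/-- The equation that prescribes the input `N` at the times marked by the start flag. -/
noncomputable def inputEq (K : Type*) [Field K] (R N : ℕ) : DiffPoly (R + 4) K :=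
  indet K R 0 0 * (indet K R 5 0 - (N : DiffPoly (R + 4) K))

/-- The values `v` of the variables represent the configuration `c` of an active machine. -/
def Represents {k : Type*} [Field k] (R : ℕ) (v : ℕ → k) (c : Config) : Prop :=
  v 1 = 1 ∧ v 3 = c.1 ∧ ∀ r < R, v (r + 4) = c.2 r

section Eval

variable {K k : Type*} [Field K] [Field k] {R : ℕ} (E : DiffPoly (R + 4) K →+* k)

theorem represents_exec [CharZero k] {c : Config} {I : Instr} (hI : UsesBelow R I)
    (hc : Represents R (fun i => E (indet K R i 0)) c) (hact : E (indet K R 1 1) = 1)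
    (h : ∀ f ∈ execEqs K R c.1 I, E f = 0) :
    Represents R (fun i => E (indet K R i 1)) (exec I c) := by
  obtain ⟨-, -, hreg⟩ := hc
  obtain ⟨j, x⟩ := c
  refine ⟨hact, ?_⟩
  cases I with
  | affine r c s d =>
    simp only [execEqs, List.mem_cons, forall_eq_or_imp, List.forall_mem_map, List.mem_range,
      map_sub, map_natCast, sub_eq_zero] at h
    refine ⟨h.1, fun q hq => ?_⟩
    simp only [h.2 q hq, exec, Function.update_apply]
    split_ifs with e
    · simp [hreg s hI.2]
    · exact hreg q hq
  | jeq a b l =>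
    simp only [execEqs, List.mem_cons, forall_eq_or_imp, List.forall_mem_map, List.mem_range,
      map_sub, map_mul, map_natCast, map_one, hreg a hI.1, hreg b hI.2] at h
    obtain ⟨h1, h2, h3⟩ := h
    refine ⟨?_, fun q hq => (sub_eq_zero.1 (h3 q hq)).trans (hreg q hq)⟩
    by_cases e : x a = x b
    · have := h2
      simp only [e, sub_self, zero_mul, zero_sub, mul_neg, mul_one, neg_eq_zero] at this
      simpa [e, exec] using sub_eq_zero.1 this
    · have : (x a - x b : k) ≠ 0 := sub_ne_zero.2 (by exact_mod_cast e)
      simpa [e, exec, sub_eq_zero, this] using h1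

theorem eval_execEqs [CharZero k] {c : Config} {I : Instr} (hI : UsesBelow R I)
    (hc : Represents R (fun i => E (indet K R i 0)) c)
    (hw : ∀ a b l, I = .jeq a b l → E (indet K R 2 0) = (c.2 a - c.2 b : k)⁻¹)
    (hc' : Represents R (fun i => E (indet K R i 1)) (exec I c)) :
    ∀ f ∈ execEqs K R c.1 I, E f = 0 := by
  obtain ⟨-, -, hreg⟩ := hc
  obtain ⟨-, hpc', hreg'⟩ := hc'
  obtain ⟨j, x⟩ := c
  cases I with
  | affine r c s d =>
    simp only [execEqs, List.mem_cons, forall_eq_or_imp, List.forall_mem_map, List.mem_range,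
      map_sub, map_natCast, sub_eq_zero]
    refine ⟨hpc', fun q hq => (hreg' q hq).trans ?_⟩
    simp only [exec, Function.update_apply]
    split_ifs with e
    · simp [hreg s hI.2]
    · exact (hreg q hq).symm
  | jeq a b l =>
    simp only [execEqs, List.mem_cons, forall_eq_or_imp, List.forall_mem_map, List.mem_range,
      map_sub, map_mul, map_natCast, map_one, hreg a hI.1, hreg b hI.2, hw a b l rfl, hpc']
    refine ⟨?_, ?_, fun q hq => sub_eq_zero.2 ((hreg' q hq).trans (hreg q hq).symm)⟩
    · by_cases e : x a = x b <;> simp [e, exec]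
    · by_cases e : x a = x b
      · simp [e, exec]
      · have : (x a - x b : k) ≠ 0 := sub_ne_zero.2 (by exact_mod_cast e)
        simp [this]

theorem forall_mem_stepEqs {P : List Instr} : (∀ f ∈ stepEqs K P R, E f = 0) ↔
    E (indet K R 1 1) = 1 ∧ ∏ i ∈ Finset.range P.length, (E (indet K R 3 0) - (i : k)) = 0 ∧
      ∀ j I, P[j]? = some I → ∀ f ∈ execEqs K R j I,
        (∏ i ∈ (Finset.range P.length).erase j, (E (indet K R 3 0) - (i : k))) * E f = 0 := by
  simp only [stepEqs, List.mem_cons, forall_eq_or_imp, List.mem_flatMap, List.mem_map,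
    List.mem_zipIdx_iff_getElem?, map_sub, map_one, map_prod, map_natCast, sub_eq_zero]
  refine and_congr_right fun _ => and_congr_right fun _ => ⟨fun h j I hI f hf => ?_, ?_⟩
  · simpa using h _ ⟨(I, j), hI, f, hf, rfl⟩
  · rintro h _ ⟨⟨I, j⟩, hI, f, hf, rfl⟩
    simpa using h j I hI f hf

theorem represents_step [CharZero k] {P : List Instr} (hP : ∀ I ∈ P, UsesBelow R I) {c : Config}
    (hc : Represents R (fun i => E (indet K R i 0)) c) (h : ∀ f ∈ stepEqs K P R, E f = 0) :
    c.1 < P.length ∧ Represents R (fun i => E (indet K R i 1)) (step P c) := by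
  obtain ⟨h1, h2, h3⟩ := (forall_mem_stepEqs E).1 h
  have hpc : E (indet K R 3 0) = c.1 := hc.2.1
  rw [hpc] at h2 h3
  obtain ⟨i, hi, e⟩ := Finset.prod_eq_zero_iff.1 h2
  have hlt : c.1 < P.length := by
    rw [sub_eq_zero, Nat.cast_inj] at e
    simpa [e] using hi
  refine ⟨hlt, ?_⟩
  have hget : P[c.1]? = some P[c.1] := List.getElem?_eq_getElem hlt
  simp only [step, hget]
  refine represents_exec E (hP _ (List.getElem_mem hlt)) hc h1 fun f hf =>
    (mul_eq_zero.1 (h3 _ _ hget f hf)).resolve_left (Finset.prod_ne_zero_iff.2 fun i hi => ?_)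
  rw [sub_ne_zero, Ne, Nat.cast_inj]
  exact (Finset.ne_of_mem_erase hi).symm

theorem eval_stepEqs [CharZero k] {P : List Instr} (hP : ∀ I ∈ P, UsesBelow R I) {c : Config}
    (hlt : c.1 < P.length) (hc : Represents R (fun i => E (indet K R i 0)) c)
    (hw : ∀ a b l, P[c.1]? = some (.jeq a b l) → E (indet K R 2 0) = (c.2 a - c.2 b : k)⁻¹)
    (hc' : Represents R (fun i => E (indet K R i 1)) (step P c)) :
    ∀ f ∈ stepEqs K P R, E f = 0 := by
  have hpc : E (indet K R 3 0) = c.1 := hc.2.1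
  rw [forall_mem_stepEqs, hpc]
  refine ⟨hc'.1, Finset.prod_eq_zero (Finset.mem_range.2 hlt) (sub_self _), fun j I hI f hf => ?_⟩
  obtain rfl | hj := eq_or_ne c.1 j
  · simp only [step, hI] at hc'
    rw [eval_execEqs E (hP I (List.mem_of_getElem? hI)) hc (fun a b l e => hw a b l (e ▸ hI)) hc'
      f hf, mul_zero]
  · rw [Finset.prod_eq_zero (Finset.mem_erase.2 ⟨hj, Finset.mem_range.2 hlt⟩) (sub_self _),
      zero_mul]

theorem represents_initial {N : ℕ} (hN : E (inputEq K R N) = 0)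
    (h : ∀ f ∈ (initEqs K R).map (indet K R 0 0 * ·), E f = 0) (h0 : E (indet K R 0 0) ≠ 0) :
    Represents R (fun i => E (indet K R i 0)) (initial N) := by
  simp only [initEqs, List.map_cons, List.mem_cons, forall_eq_or_imp, List.forall_mem_map,
    List.mem_filter, List.mem_range, map_mul, map_sub, map_one, mul_eq_zero, h0, false_or,
    sub_eq_zero, decide_eq_true_eq, inputEq, map_natCast] at h hN
  refine ⟨h.1, by simpa [initial] using h.2.1, fun r hr => ?_⟩
  by_cases e : r = 1
  · subst e; simpa [initial] using hN
  · simpa [initial, e] using h.2.2 r ⟨hr, e⟩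

end Eval

section Sequences

variable (M : Type*) [AddMonoidWithOne M] {K k : Type*} [Field K] [Field k] [Algebra K k] {R : ℕ}

/-- The value of a difference polynomial at the time `m`, as a ring homomorphism. -/
noncomputable def evalAt (x : Fin (R + 4) → M → k) (m : M) : DiffPoly (R + 4) K →+* k :=
  (Pi.evalRingHom (fun _ : M => k) m).comp
    (aeval fun v : Fin (R + 4) × ℕ => (seqShift M k)^[v.2] (x v.1)).toRingHom

@[simp] theorem evalAt_indet_zero (x : Fin (R + 4) → M → k) (m : M) (i : ℕ) :
    evalAt M x m (indet K R i 0) = x (varIndex R i) m := by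
  simp [evalAt, indet]

@[simp] theorem evalAt_indet_one (x : Fin (R + 4) → M → k) (m : M) (i : ℕ) :
    evalAt M x m (indet K R i 1) = x (varIndex R i) (m + 1) := by
  simp [evalAt, indet, seqShift]

theorem evalSeq_eq_zero_iff (x : Fin (R + 4) → M → k) (f : DiffPoly (R + 4) K) :
    DiffPoly.evalSeq M x f = 0 ↔ ∀ m, evalAt M x m f = 0 :=
  funext_iff

/-- On a solution of the system, a time with nonvanishing start flag starts a run of the machine. -/
theorem represents_iterate [CharZero k] {P : List Instr} (hP : ∀ I ∈ P, UsesBelow R I) {N : ℕ}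
    {x : Fin (R + 4) → M → k}
    (hx : ∀ f ∈ inputEq K R N :: machineEqs K P R, DiffPoly.evalSeq M x f = 0) {m : M}
    (hm : x (varIndex R 0) m ≠ 0) (t : ℕ) :
    Represents R (fun i => x (varIndex R i) (m + t)) ((step P)^[t] (initial N)) ∧
      ((step P)^[t] (initial N)).1 < P.length := by
  simp only [evalSeq_eq_zero_iff, List.mem_cons, forall_eq_or_imp, machineEqs,
    List.forall_mem_append] at hx
  obtain ⟨hN, hs, hi⟩ := hx
  have next (n : M) (c : Config) (hc : Represents R (fun i => x (varIndex R i) n) c) :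
      c.1 < P.length ∧ Represents R (fun i => x (varIndex R i) (n + 1)) (step P c) := by
    have h1 : x (varIndex R 1) n = 1 := hc.1
    have := represents_step (evalAt (K := K) M x n) hP (c := c)
    simp only [evalAt_indet_zero, evalAt_indet_one] at this
    refine this hc fun f hf => ?_
    simpa [h1] using hs _ (List.mem_map_of_mem hf) n
  have rep : Represents R (fun i => x (varIndex R i) (m + t)) ((step P)^[t] (initial N)) := by
    induction t with
    | zero =>
      have := represents_initial (evalAt (K := K) M x m) (hN m) (fun f hf => hi f hf m)
        (by simpa using hm)
      simpa using this
    | succ t ih =>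
      rw [Function.iterate_succ_apply', Nat.cast_succ, ← add_assoc]
      exact (next _ _ ih).2
  exact ⟨rep, (next _ _ rep).1⟩

/-- The value of the variable number `i` in the configuration `c` of the program `P`. The value `0`
of the start flag is a placeholder: this flag depends on the time. -/
noncomputable def configValue (k : Type*) [Field k] (P : List Instr) (c : Config) : ℕ → k
  | 0 => 0
  | 1 => 1
  | 2 => match P[c.1]? with
    | some (.jeq a b _) => (c.2 a - c.2 b : k)⁻¹
    | _ => 0
  | 3 => c.1
  | r + 4 => c.2 r

/-- The solution given by the run of the program `P` on the input `N` that starts at time `0`; all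
variables vanish at negative times. -/
noncomputable def runSolution (k : Type*) [Field k] (P : List Instr) (N : ℕ) (R : ℕ) (d : M → ℤ) :
    Fin (R + 4) → M → k := fun i m =>
  if d m < 0 then 0 else
    if (i : ℕ) = 0 then if d m = 0 then 1 else 0
    else configValue k P ((step P)^[(d m).toNat] (initial N)) i

/-- The system forces the start flag to vanish identically if and only if the program halts. The
sequences may be indexed by any `M` on which a time `d` is defined. -/
theorem holdsOnSolutions_iff [CharZero k] {P : List Instr} (hP : ∀ I ∈ P, UsesBelow R I)
    (hR : 2 ≤ R) (N : ℕ) (d : M → ℤ) (hd : ∀ m, d (m + 1) = d m + 1) (hd0 : d 0 = 0) :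
    HoldsOnSolutions M k (inputEq K R N :: machineEqs K P R) (indet K R 0 0) ↔
      ∃ t, P.length ≤ ((step P)^[t] (initial N)).1 := by
  constructor
  · intro h
    by_contra! hrun
    -- A machine that never halts yields a solution whose start flag is `1` at time `0`.
    set x := runSolution M k P N R d with hx
    have hval (m : M) (hm : 0 ≤ d m) (i : ℕ) (hi : i < R + 4) (hi0 : i ≠ 0) :
        x (varIndex R i) m = configValue k P ((step P)^[(d m).toNat] (initial N)) i := by
      simp [hx, runSolution, hm.not_gt, val_varIndex hi, hi0]
    have hneg (m : M) (hm : d m < 0) (i : Fin (R + 4)) : x i m = 0 := by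
      simp [hx, runSolution, hm]
    have hstart (m : M) : x (varIndex R 0) m = if d m = 0 then 1 else 0 := by
      simp only [hx, runSolution, val_varIndex (show 0 < R + 4 by omega), if_true]
      split_ifs <;> first | rfl | omega
    have hrep (m : M) (hm : 0 ≤ d m) : Represents R (fun i => x (varIndex R i) m)
        ((step P)^[(d m).toNat] (initial N)) := by
      refine ⟨?_, ?_, fun r hr => ?_⟩
      · exact hval m hm 1 (by omega) (by omega)
      · exact hval m hm 3 (by omega) (by omega)
      · exact hval m hm (r + 4) (by omega) (by omega)
    have hsol : ∀ f ∈ inputEq K R N :: machineEqs K P R, DiffPoly.evalSeq M x f = 0 := by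
      simp only [evalSeq_eq_zero_iff]
      intro f hf m
      rcases lt_or_ge (d m) 0 with hm | hm
      · simp only [inputEq, machineEqs, List.mem_cons, List.mem_append, List.mem_map] at hf
        rcases hf with rfl | ⟨g, -, rfl⟩ | ⟨g, -, rfl⟩ <;> simp [hneg m hm]
      · have hrep0 := hrep m hm
        have hrep1 := hrep (m + 1) (by rw [hd]; omega)
        rw [hd, show (d m + 1).toNat = (d m).toNat + 1 by omega,
          Function.iterate_succ_apply'] at hrep1
        have hinit : d m = 0 → Represents R (fun i => x (varIndex R i) m) (initial N) := by
          intro e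
          simpa [e] using hrep0
        simp only [machineEqs, List.mem_cons, List.mem_append] at hf
        rcases hf with rfl | hf | hf
        · by_cases e : d m = 0
          · have := (hinit e).2.2 1 hR
            simp only [initial, Function.update_self] at this
            simp [inputEq, this]
          · simp [inputEq, hstart, e]
        · obtain ⟨g, hg, rfl⟩ := List.mem_map.1 hf
          have := eval_stepEqs (evalAt (K := K) M x m) hP (hrun (d m).toNat)
            (by simpa using hrep0) (fun a b l e => ?_) (by simpa using hrep1) g hg
          · simp [this]
          · simp only [evalAt_indet_zero]
            rw [hval m hm 2 (by omega) (by omega)]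
            simp [configValue, e]
        · by_cases e : d m = 0
          · obtain ⟨h1, h2, h3⟩ := hinit e
            obtain ⟨g, hg, rfl⟩ := List.mem_map.1 hf
            simp only [initEqs, List.mem_cons, List.mem_map, List.mem_filter, List.mem_range,
              decide_eq_true_eq] at hg
            rcases hg with rfl | rfl | ⟨r, ⟨hr, hr1⟩, rfl⟩
            · simp [show x (varIndex R 1) m = 1 from h1]
            · simpa [initial] using Or.inr h2
            · simp [h3 r hr, initial, hr1]
          · obtain ⟨g, hg, rfl⟩ := List.mem_map.1 hf
            simp [hstart, e]
    have := (evalSeq_eq_zero_iff M x _).1 (h x hsol) 0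
    simp [hstart, hd0] at this
  · rintro ⟨t, ht⟩ x hx
    rw [evalSeq_eq_zero_iff]
    intro m
    by_contra hm
    exact ht.not_gt (represents_iterate M hP hx (m := m) (by simpa using hm) t).2

end Sequences

end RegisterMachine

/-! ### Computable descriptions of the systems -/

namespace ComputablePresentation

open MvPolynomial

variable {K : Type*} [Field K] (ν : ComputablePresentation K) {n : ℕ}

theorem exists_codes (f : DiffPoly n K) : ∃ c, ν.Codes c f := by
  suffices h : ∃ t : List (ℕ × List (Fin n × ℕ)),
      f = (t.map fun s => C (ν.elt s.1) * (s.2.map X).prod).sum by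
    obtain ⟨t, ht⟩ := h
    exact ⟨_, t, rfl, ht⟩
  induction f using MvPolynomial.induction_on with
  | C a =>
    obtain ⟨m, rfl⟩ := ν.surjective_elt a
    exact ⟨[(m, [])], by simp⟩
  | add p q hp hq =>
    obtain ⟨s, rfl⟩ := hp
    obtain ⟨t, rfl⟩ := hq
    exact ⟨s ++ t, by simp⟩
  | mul_X p v hp =>
    obtain ⟨t, rfl⟩ := hp
    refine ⟨t.map fun s => (s.1, v :: s.2), ?_⟩
    rw [← List.sum_map_mul_right, List.map_map]
    congr 2
    funext s
    simp only [Function.comp, List.map_cons, List.prod_cons]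
    ring

theorem exists_forall₂_codes (F : List (DiffPoly n K)) : ∃ c, List.Forall₂ ν.Codes c F := by
  induction F with
  | nil => exact ⟨[], .nil⟩
  | cons f F ih =>
    obtain ⟨c, hc⟩ := ν.exists_codes f
    obtain ⟨cs, hcs⟩ := ih
    exact ⟨c :: cs, .cons hc hcs⟩

/-- Names of the multiples of an element can be computed. -/
theorem exists_computable_nsmul (a : K) :
    ∃ h : ℕ → ℕ, Computable h ∧ ∀ N : ℕ, ν.elt (h N) = N * a := by
  obtain ⟨add, hadd, hadd'⟩ := ν.computable_add
  obtain ⟨z, hz⟩ := ν.surjective_elt 0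
  obtain ⟨m, rfl⟩ := ν.surjective_elt a
  refine ⟨fun N => Nat.rec z (fun _ y => add y m) N, ?_, fun N => ?_⟩
  · exact Computable.nat_rec .id (.const z)
      (hadd.comp (Computable.snd.comp .snd) (.const m)).to₂
  · induction N with
    | zero => simpa using hz
    | succ N ih => rw [hadd', ih]; push_cast; ring

end ComputablePresentation

open RegisterMachine MvPolynomial in
/-- A decision procedure would decide the halting problem, as the description of the system of a
fixed program with input `N` can be computed from `N`. -/
theorem not_decidableConsequence {k : Type*} [Field k] [CharZero k] {K : Type*} [Field K]
    [Algebra K k] (ν : ComputablePresentation K) (M : Type*) [AddMonoidWithOne M] (d : M → ℤ)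
    (hd : ∀ m, d (m + 1) = d m + 1) (hd0 : d 0 = 0) : ¬ DecidableConsequence M ν k := by
  rintro ⟨D, hD, hD'⟩
  obtain ⟨P, hP⟩ := exists_program_halting
  obtain ⟨R, hR, hPR⟩ := exists_usesBelow P
  obtain ⟨cF, hcF⟩ := ν.exists_forall₂_codes (machineEqs K P R)
  obtain ⟨cg, hcg⟩ := ν.exists_codes (indet K R 0 0)
  obtain ⟨one, hone⟩ := ν.surjective_elt 1
  obtain ⟨neg, hneg, hneg'⟩ := ν.exists_computable_nsmul (-1)
  let input (N : ℕ) : InputCode :=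
    (R + 4, [(one, [(0, 0), (5, 0)]), (neg N, [(0, 0)])] :: cF, cg)
  have hinput : Computable input :=
    (Computable.const (R + 4)).pair ((Computable.list_cons.comp
      (Computable.list_cons.comp (.const (one, [(0, 0), (5, 0)]))
        (Computable.list_cons.comp (hneg.pair (.const [(0, 0)])) (.const []))) (.const cF)).pair
      (.const cg))
  have hcodes (N : ℕ) : ν.CodesInput (input N) (inputEq K R N :: machineEqs K P R)
      (indet K R 0 0) := by
    refine ⟨rfl, .cons ⟨[(one, [(varIndex R 0, 0), (varIndex R 5, 0)]),
      (neg N, [(varIndex R 0, 0)])], ?_, ?_⟩ hcF, hcg⟩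
    · simp [val_varIndex (show 0 < R + 4 by omega), val_varIndex (show 5 < R + 4 by omega)]
    · simp only [inputEq, indet, hone, hneg', List.map_cons, List.map_nil, List.prod_cons,
        List.prod_nil, List.sum_cons, List.sum_nil, map_one, map_mul, map_neg, map_natCast]
      ring
  refine ComputablePred.halting_problem 0 (ComputablePred.computable_iff.2
    ⟨fun c => D (input (Encodable.encode c)), hD.comp (hinput.comp .encode), funext fun c => ?_⟩)
  rw [hD' _ _ _ _ (hcodes _), holdsOnSolutions_iff M hPR hR _ d hd hd0, hP,
    Denumerable.ofNat_encode]

theorem mainTheorem3 {k : Type*} [Field k] [CharZero k] (k₀ : Subfield k)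
    (ν : ComputablePresentation k₀) :
    ¬ DecidableConsequence ℕ ν k ∧ ¬ DecidableConsequence ℤ ν k :=
  ⟨not_decidableConsequence ν ℕ (fun m => m) (fun _ => by push_cast; rfl) rfl,
    not_decidableConsequence ν ℤ id (fun _ => rfl) rfl⟩
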